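/- Let $\mathbb K$ be a commutative field, let $(X,d)$ be a non-empty extended metric space ($d$ may take the value $\infty$) that is locally finite, i.e. every subset of finite diameter is finite, and let $n\ge 2$ be an integer. A partial translation on $X$ is a bijection $t\colon A\to B$ between subsets $A,B\subseteq X$ with $\sup_{x\in A}d(x,t(x))<\infty$. It acts on the vector space $\mathbb K[X]$ with basis $(\delta_x)_{x\in X}$ by $V_t\delta_x=\delta_{t(x)}$ if $x\in A$ and $V_t\delta_x=0$ otherwise. The translation $\mathbb K$-algebra $\mathbb K_{\mathrm u}(X)$ is the unital $\mathbb K$-subalgebra of $\operatorname{End}_{\mathbb K}(\mathbb K[X])$ generated by all $V_t$. The following conditions are equivalent: 1. $(X,d)$ is amenable: for all $R>0$ and $\varepsilon>0$ there is a finite non-empty $F\subseteq X$ with $|\partial_RF|\le\varepsilon|F|$, where $\partial_RF=\{x\in X: d(x,F)\le R,\ d(x,X\setminus F)\le R\}$ and $d(x,\emptyset)=\infty$. 2. $\mathbb K_{\mathrm u}(X)$ is (left) algebraically amenable: for every $\varepsilon>0$ and every finite $\mathcal F\subseteq\mathbb K_{\mathrm u}(X)$ there is a nonzero finite-dimensional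 linear subspace $W\subseteq\mathbb K_{\mathrm u}(X)$ with $\dim(aW+W)\le(1+\varepsilon)\dim W$ for all $a\in\mathcal F$. 3. $\mathbb K_{\mathrm u}(X)$ is not properly infinite. Here a nonzero unital algebra $\mathcal A$ is properly infinite if there are idempotents $e_1,e_2\in\mathcal A$ with $e_1e_2=e_2e_1=0$ and $e_1\sim 1\sim e_2$, where $e\sim f$ means that $e=xy$ and $f=yx$ for some $x,y\in\mathcal A$. 4. $\mathbb K_{\mathrm u}(X)$ does not contain the Leavitt algebra $L_{\mathbb K}(1,n)$ as a unital $\mathbb K$-subalgebra, i.e. there is no injective unital $\mathbb K$-algebra homomorphism $L_{\mathbb K}(1,n)\to\mathbb K_{\mathrm u}(X)$. Here $L_{\mathbb K}(1,n)$ is the unital $\mathbb K$-algebra generated by $X_1,\dots,X_n,Y_1,\dots,Y_n$ subject to the relations $\sum_{j=1}^nX_jY_j=1$ and $Y_jX_k=\delta_{jk}1$ for $1\le j,k\le n$. -/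

import Mathlib

open scoped ENNReal

noncomputable section

namespace CoarseAmenability

/-! ## Extended metric spaces -/

section Space

variable {X : Type*} [EMetricSpace X]

/-- An extended metric space is locally finite if every bounded subset, that is, every subset of
finite diameter, is finite. -/
def IsLocallyFinite (X : Type*) [EMetricSpace X] : Prop :=
  ∀ s : Set X, Metric.ediam s < ∞ → s.Finite

/-- The `R`-boundary `{x | d(x, A) ≤ R and d(x, X \ A) ≤ R}` of a subset `A`, where the distance
to the empty set is `∞`. -/
def rBoundary (R : ℝ) (A : Set X) : Set X :=
  {x | Metric.infEDist x A ≤ ENNReal.ofReal R ∧ Metric.infEDist x Aᶜ ≤ ENNReal.ofReal R}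

/-- `F` is an `(R, ε)`-Følner set. The `R`-boundary of a finite subset of a locally finite space
is finite, so that `Set.ncard` is its number of elements. -/
def IsFolnerSet (R ε : ℝ) (F : Finset X) : Prop :=
  F.Nonempty ∧ ((rBoundary R (F : Set X)).ncard : ℝ) / (F.card : ℝ) ≤ ε

/-- Amenability of a (locally finite) extended metric space. -/
def IsAmenable (X : Type*) [EMetricSpace X] : Prop :=
  ∀ R : ℝ, 0 < R → ∀ ε : ℝ, 0 < ε → ∃ F : Finset X, IsFolnerSet R ε F

/-- A partial translation of `X`: a bijection between two subsets of `X` whose graph is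
controlled. -/
structure PartialTranslation (X : Type*) [EMetricSpace X] where
  /-- the domain -/
  dom : Set X
  /-- the range -/
  ran : Set X
  /-- the bijection -/
  toEquiv : dom ≃ ran
  controlled : (⨆ x : dom, edist (x : X) (toEquiv x : X)) < ∞

end Space

/-! ## The translation algebra -/

section Translation

variable (K : Type*) [Field K] {X : Type*} [EMetricSpace X]

open Classical in
/-- The endomorphism `V_t` of `K[X]` given on the basis by `δ_x ↦ δ_{t(x)}` if `x` lies in the
domain of `t`, and `δ_x ↦ 0` otherwise. -/
def PartialTranslation.toEnd (t : PartialTranslation X) : Module.End K (X →₀ K) :=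
  Finsupp.linearCombination K fun x : X =>
    if h : x ∈ t.dom then Finsupp.single (t.toEquiv ⟨x, h⟩ : X) (1 : K) else 0

/-- The translation `K`-algebra of `X`: the unital subalgebra of `End_K(K[X])` generated by all
`V_t`. -/
def translationAlgebra (X : Type*) [EMetricSpace X] : Subalgebra K (Module.End K (X →₀ K)) :=
  Algebra.adjoin K (Set.range fun t : PartialTranslation X => t.toEnd K)

/-- The translation algebra is a ring: its additive inverse is multiplication by `-1 ∈ K`, and its
other operations are those of the subalgebra. -/
instance instRingTranslationAlgebra (X : Type*) [EMetricSpace X] : Ring (translationAlgebra K X) :=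
  Algebra.semiringToRing K

end Translation

/-! ## Algebras over a field -/

section Alg

variable (K : Type*) [Field K] {A : Type*} [Ring A] [Algebra K A]

/-- `W` is a (left) `(S, ε)`-Følner subspace: a nonzero finite-dimensional subspace with
`dim (a W + W) / dim W ≤ 1 + ε` for all `a ∈ S`. -/
def IsFolnerSubspace (S : Finset A) (ε : ℝ) (W : Submodule K A) : Prop :=
  W ≠ ⊥ ∧ FiniteDimensional K W ∧
    ∀ a ∈ S,
      (Module.finrank K ↥(W.map (LinearMap.mulLeft K a) ⊔ W) : ℝ) / (Module.finrank K W : ℝ) ≤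
        1 + ε

/-- (Left) algebraic amenability of a `K`-algebra. -/
def IsAlgebraicallyAmenable (A : Type*) [Ring A] [Algebra K A] : Prop :=
  ∀ ε : ℝ, 0 < ε → ∀ S : Finset A, ∃ W : Submodule K A, IsFolnerSubspace K S ε W

/-- Murray–von Neumann equivalence (of idempotents): `e = x y` and `f = y x` for some `x`, `y`. -/
def MvNEquiv {A : Type*} [Ring A] (e f : A) : Prop :=
  ∃ x y : A, e = x * y ∧ f = y * x

/-- An idempotent `e` is properly infinite if the corner `e A e` contains orthogonal idempotents
`e₁`, `e₂` that are both equivalent to `e`. -/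
def IsProperlyInfiniteIdempotent {A : Type*} [Ring A] (e : A) : Prop :=
  IsIdempotentElem e ∧
    ∃ e₁ e₂ : A,
      (∃ a, e₁ = e * a * e) ∧ (∃ b, e₂ = e * b * e) ∧
        IsIdempotentElem e₁ ∧ IsIdempotentElem e₂ ∧ e₁ * e₂ = 0 ∧ e₂ * e₁ = 0 ∧
        MvNEquiv e₁ e ∧ MvNEquiv e e₂

/-- A nonzero unital algebra is properly infinite if its unit is a properly infinite idempotent. -/
def IsProperlyInfinite (A : Type*) [Ring A] : Prop :=
  Nontrivial A ∧ IsProperlyInfiniteIdempotent (1 : A)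

end Alg

/-! ## Leavitt algebras -/

section Leavitt

variable (K : Type*) [Field K] (m n : ℕ)

/-- Indices of the generators of the Leavitt algebra: `Sum.inl (i, j)` stands for `X i j` and
`Sum.inr (j, i)` for `Y j i`. -/
abbrev LeavittGen : Type := (Fin m × Fin n) ⊕ (Fin n × Fin m)

/-- The `m × n` matrix of the generators `X i j` in the free algebra. -/
def leavittX : Matrix (Fin m) (Fin n) (FreeAlgebra K (LeavittGen m n)) :=
  Matrix.of fun i j => FreeAlgebra.ι K (Sum.inl (i, j))

/-- The `n × m` matrix of the generators `Y j i` in the free algebra. -/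
def leavittY : Matrix (Fin n) (Fin m) (FreeAlgebra K (LeavittGen m n)) :=
  Matrix.of fun j i => FreeAlgebra.ι K (Sum.inr (j, i))

/-- The defining relations `X Y = 1` and `Y X = 1`, entry by entry. -/
inductive LeavittRel :
    FreeAlgebra K (LeavittGen m n) → FreeAlgebra K (LeavittGen m n) → Prop
  | xy (i i' : Fin m) :
      LeavittRel ((leavittX K m n * leavittY K m n) i i')
        ((1 : Matrix (Fin m) (Fin m) (FreeAlgebra K (LeavittGen m n))) i i')
  | yx (j j' : Fin n) :
      LeavittRel ((leavittY K m n * leavittX K m n) j j')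
        ((1 : Matrix (Fin n) (Fin n) (FreeAlgebra K (LeavittGen m n))) j j')

/-- The Leavitt algebra `L_K(m, n)`. -/
abbrev LeavittAlgebra : Type _ := RingQuot (LeavittRel K m n)

/-- The unital `K`-algebra `A` contains the unital `K`-algebra `B` as a unital `K`-subalgebra, up
to isomorphism. -/
def ContainsUnitally (A B : Type*) [Ring A] [Algebra K A] [Ring B] [Algebra K B] : Prop :=
  ∃ φ : B →ₐ[K] A, Function.Injective φ

end Leavitt

end CoarseAmenability

end

open scoped ENNReal

noncomputable section

/-! The four conditions are linked in a cycle, 1 → 2 → 3 → 4 → 1.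

1 → 2: fix a base point `b` in each class of points at finite distance, and let `e_x` be the matrix
unit sending `δ_b` to `δ_x`. The `e_x` are linearly independent, and `a * e_x` is a combination of
`e_y` with `y` within the propagation of `a`. Hence the `e_x` with `x` in a Følner set span a Følner
subspace.

2 → 3: proper infiniteness gives two left-invertible elements with independent images, so `W` would
have two independent copies inside a space barely larger than `W`.

3 → 4: two of the `n ≥ 2` generators of a Leavitt algebra already witness proper infiniteness.

4 → 1: a non-amenable space expands at some scale by a factor `n`. Hall's marriage theorem and a
Schröder–Bernstein argument then give a bijection `X × Fin n → X` of bounded displacement, and its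
`n` branches and their inverses satisfy the Leavitt relations. The resulting homomorphism is
injective by `IsLeavittFamily.injective_algHom`. -/

namespace CoarseAmenability

/-! ### Expansion and paradoxical decompositions. -/

section Neighbourhoods

variable {X : Type*} [EMetricSpace X]

/-- The closed `R`-neighbourhood of a set, with the distance attained. -/
def neighbourhood (R : ℝ) (A : Set X) : Set X :=
  {y | ∃ x ∈ A, edist x y ≤ ENNReal.ofReal R}

theorem subset_neighbourhood (R : ℝ) (A : Set X) : A ⊆ neighbourhood R A :=
  fun x hx => ⟨x, hx, by simp⟩

theorem neighbourhood_neighbourhood_subset {R S : ℝ} (hR : 0 ≤ R) (hS : 0 ≤ S) (A : Set X) :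
    neighbourhood S (neighbourhood R A) ⊆ neighbourhood (R + S) A := by
  rintro z ⟨y, ⟨x, hx, hxy⟩, hyz⟩
  refine ⟨x, hx, ?_⟩
  rw [ENNReal.ofReal_add hR hS]
  exact (edist_triangle x y z).trans (add_le_add hxy hyz)

theorem IsLocallyFinite.finite_closedEBall (hX : IsLocallyFinite X) (x : X) {r : ℝ≥0∞}
    (hr : r < ∞) : (Metric.closedEBall x r).Finite :=
  hX _ (Metric.ediam_closedEBall_le.trans_lt (ENNReal.mul_lt_top (by simp) hr))

theorem IsLocallyFinite.finite_neighbourhood (hX : IsLocallyFinite X) (R : ℝ) {A : Set X}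
    (hA : A.Finite) : (neighbourhood R A).Finite := by
  refine (hA.biUnion fun x _ =>
    hX.finite_closedEBall x (r := ENNReal.ofReal R) ENNReal.ofReal_lt_top).subset ?_
  rintro y ⟨x, hx, hxy⟩
  simp only [Set.mem_iUnion]
  exact ⟨x, hx, by rwa [Metric.mem_closedEBall, edist_comm]⟩

/-- In a locally finite space the distance to a set is attained. -/
theorem IsLocallyFinite.exists_edist_le (hX : IsLocallyFinite X) {x : X} {A : Set X} {r : ℝ≥0∞}
    (hr : r < ∞) (h : Metric.infEDist x A ≤ r) : ∃ y ∈ A, edist x y ≤ r := by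
  -- The slack makes the inequality strict, which yields some point of `A` in the ball of radius `r
  -- + 1`; a nearest one exists because that ball is finite.
  have hlt : r < r + 1 := ENNReal.lt_add_right hr.ne one_ne_zero
  obtain ⟨z, hz, hxz⟩ := Metric.infEDist_lt_iff.1 (h.trans_lt hlt)
  have hfin : (A ∩ Metric.closedEBall x (r + 1)).Finite :=
    (hX.finite_closedEBall x (ENNReal.add_lt_top.2 ⟨hr, by simp⟩)).inter_of_right A
  obtain ⟨y, hy, hmin⟩ := Set.exists_min_image _ (fun y => edist x y) hfin
    ⟨z, hz, by rw [Metric.mem_closedEBall, edist_comm]; exact hxz.le⟩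
  refine ⟨y, hy.1, le_trans (Metric.le_infEDist.2 fun w hw => ?_) h⟩
  by_cases hwx : edist x w ≤ r + 1
  · exact hmin w ⟨hw, by rwa [Metric.mem_closedEBall, edist_comm]⟩
  · have := hy.2
    rw [Metric.mem_closedEBall, edist_comm] at this
    exact this.trans (not_le.1 hwx).le

theorem IsLocallyFinite.rBoundary_subset_neighbourhood (hX : IsLocallyFinite X) (R : ℝ)
    (A : Set X) : rBoundary R A ⊆ neighbourhood R A := by
  rintro x ⟨hx, -⟩
  obtain ⟨y, hy, hxy⟩ := hX.exists_edist_le ENNReal.ofReal_lt_top hx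
  exact ⟨y, hy, by rwa [edist_comm]⟩

theorem IsLocallyFinite.finite_rBoundary (hX : IsLocallyFinite X) (R : ℝ) {A : Set X}
    (hA : A.Finite) : (rBoundary R A).Finite :=
  (hX.finite_neighbourhood R hA).subset (hX.rBoundary_subset_neighbourhood R A)

theorem neighbourhood_diff_subset_rBoundary (R : ℝ) (A : Set X) :
    neighbourhood R A \ A ⊆ rBoundary R A := by
  rintro y ⟨⟨x, hx, hxy⟩, hy⟩
  refine ⟨?_, ?_⟩
  · exact (Metric.infEDist_le_edist_of_mem hx).trans (by rwa [edist_comm])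
  · rw [Metric.infEDist_zero_of_mem (show y ∈ Aᶜ from hy)]
    exact zero_le

/-- The boundary of a neighbourhood of `A` is disjoint from `A`, so it lies in a shell. -/
theorem IsLocallyFinite.rBoundary_neighbourhood_subset (hX : IsLocallyFinite X) {R : ℝ}
    (hR : 0 ≤ R) (A : Set X) :
    rBoundary R (neighbourhood R A) ⊆ neighbourhood (R + R) A \ A := by
  intro x hx
  refine ⟨neighbourhood_neighbourhood_subset hR hR A
    (hX.rBoundary_subset_neighbourhood R _ hx), fun hxA => ?_⟩
  obtain ⟨y, hy, hxy⟩ := hX.exists_edist_le ENNReal.ofReal_lt_top hx.2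
  exact hy ⟨x, hxA, hxy⟩

/-- A non-amenable locally finite space expands uniformly at some scale. -/
theorem IsLocallyFinite.exists_expansion (hX : IsLocallyFinite X) (h : ¬ IsAmenable X) :
    ∃ R : ℝ, 0 ≤ R ∧ ∃ ε : ℝ, 0 < ε ∧ ∀ F : Set X, F.Finite →
      (1 + ε) * (F.ncard : ℝ) ≤ ((neighbourhood R F).ncard : ℝ) := by
  unfold IsAmenable at h
  push Not at h
  obtain ⟨R, hR, ε, hε, h⟩ := h
  -- The failing Følner inequality is applied to the `R`-neighbourhood of `F`. Its boundary lies in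
  -- the `2R`-shell around `F`, so that shell has more than `ε * |F|` points.
  refine ⟨R + R, by linarith, ε, hε, fun F hF => ?_⟩
  rcases F.eq_empty_or_nonempty with rfl | hne
  · simp
  have hGfin := hX.finite_neighbourhood R hF
  have hFG : F.ncard ≤ (neighbourhood R F).ncard :=
    Set.ncard_le_ncard (subset_neighbourhood R F) hGfin
  have hGne : (neighbourhood R F).Nonempty := hne.mono (subset_neighbourhood R F)
  have hG := h hGfin.toFinset
  unfold IsFolnerSet at hG
  rw [not_and, not_le, Set.Finite.coe_toFinset, ← Set.ncard_eq_toFinset_card _ hGfin] at hG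
  have hpos : (0 : ℝ) < (neighbourhood R F).ncard := by
    exact_mod_cast (Set.ncard_pos hGfin).2 hGne
  have hG' := (lt_div_iff₀ hpos).1 (hG (by simpa using hGne))
  have hfin2 := hX.finite_neighbourhood (R + R) hF
  have h1 : (rBoundary R (neighbourhood R F)).ncard ≤ (neighbourhood (R + R) F \ F).ncard :=
    Set.ncard_le_ncard (hX.rBoundary_neighbourhood_subset hR.le F) hfin2.sdiff
  have h2 := Set.ncard_sdiff_add_ncard_of_subset (subset_neighbourhood (R + R) F) hfin2
  have h1' : ((rBoundary R (neighbourhood R F)).ncard : ℝ) ≤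
      ((neighbourhood (R + R) F \ F).ncard : ℝ) := by exact_mod_cast h1
  have h2' : ((neighbourhood (R + R) F \ F).ncard : ℝ) + F.ncard =
      ((neighbourhood (R + R) F).ncard : ℝ) := by exact_mod_cast h2
  have h3 : ε * (F.ncard : ℝ) ≤ ε * ((neighbourhood R F).ncard : ℝ) :=
    mul_le_mul_of_nonneg_left (by exact_mod_cast hFG) hε.le
  linarith

/-- Iterating the expansion `k` times multiplies the factor to `(1 + ε) ^ k`, which eventually
exceeds `n`, while the radii merely add up. -/
theorem IsLocallyFinite.exists_nat_expansion (hX : IsLocallyFinite X) (h : ¬ IsAmenable X)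
    (n : ℕ) : ∃ R : ℝ, 0 ≤ R ∧ ∀ F : Set X, F.Finite →
      n * F.ncard ≤ (neighbourhood R F).ncard := by
  obtain ⟨R, hR, ε, hε, hexp⟩ := hX.exists_expansion h
  have key : ∀ k : ℕ, ∃ S : ℝ, 0 ≤ S ∧ ∀ F : Set X, F.Finite →
      (1 + ε) ^ k * (F.ncard : ℝ) ≤ ((neighbourhood S F).ncard : ℝ) := by
    intro k
    induction k with
    | zero =>
      refine ⟨0, le_rfl, fun F hF => ?_⟩
      simpa using Set.ncard_le_ncard (subset_neighbourhood 0 F) (hX.finite_neighbourhood 0 hF)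
    | succ k ih =>
      obtain ⟨S, hS, ih⟩ := ih
      refine ⟨S + R, by positivity, fun F hF => ?_⟩
      have h1 := hexp _ (hX.finite_neighbourhood S hF)
      have h2 : (neighbourhood R (neighbourhood S F)).ncard ≤ (neighbourhood (S + R) F).ncard :=
        Set.ncard_le_ncard (neighbourhood_neighbourhood_subset hS hR F)
          (hX.finite_neighbourhood _ hF)
      calc (1 + ε) ^ (k + 1) * (F.ncard : ℝ) = (1 + ε) * ((1 + ε) ^ k * (F.ncard : ℝ)) := by ring
        _ ≤ (1 + ε) * ((neighbourhood S F).ncard : ℝ) :=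
          mul_le_mul_of_nonneg_left (ih F hF) (by positivity)
        _ ≤ _ := h1.trans (by exact_mod_cast h2)
  obtain ⟨k, hk⟩ := pow_unbounded_of_one_lt (n : ℝ) (show 1 < 1 + ε by linarith)
  obtain ⟨S, hS, hSF⟩ := key k
  refine ⟨S, hS, fun F hF => ?_⟩
  have : (n : ℝ) * F.ncard ≤ (neighbourhood S F).ncard :=
    (mul_le_mul_of_nonneg_right hk.le (by positivity)).trans (hSF F hF)
  exact_mod_cast this

/-- A non-amenable locally finite space is the disjoint union of `n` subsets that are the images
of translations of the whole space. -/
theorem IsLocallyFinite.exists_paradoxical (hX : IsLocallyFinite X) (h : ¬ IsAmenable X)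
    (n : ℕ) [NeZero n] : ∃ R : ℝ, ∃ f : X × Fin n → X, Function.Bijective f ∧
      ∀ p, edist p.1 (f p) ≤ ENNReal.ofReal R := by
  classical
  obtain ⟨R, -, hexp⟩ := hX.exists_nat_expansion h n
  have hball : ∀ x : X, (Metric.closedEBall x (ENNReal.ofReal R)).Finite := fun x =>
    hX.finite_closedEBall x ENNReal.ofReal_lt_top
  -- Hall's theorem, with the `R`-ball around `x` as the candidates for each `(x, i)`. A finite set
  -- of pairs has at most `n` elements over each first coordinate, so the `n`-fold expansion is
  -- Hall's condition.
  obtain ⟨f, hf, hfR⟩ := (Finset.all_card_le_biUnion_card_iff_exists_injective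
    (fun p : X × Fin n => (hball p.1).toFinset)).1 fun s => by
      have h1 : s ⊆ s.image Prod.fst ×ˢ Finset.univ := fun p hp => by
        simpa using ⟨p.2, hp⟩
      have h2 := Finset.card_le_card h1
      rw [Finset.card_product, Finset.card_univ, Fintype.card_fin, mul_comm] at h2
      have h3 := hexp (s.image Prod.fst : Finset X) (Finset.finite_toSet _)
      rw [Set.ncard_coe_finset] at h3
      refine (h2.trans h3).trans ?_
      rw [← Set.ncard_coe_finset]
      refine Set.ncard_le_ncard ?_ (Finset.finite_toSet _)
      rintro y ⟨x, hx, hxy⟩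
      obtain ⟨p, hp, rfl⟩ := Finset.mem_image.1 (Finset.mem_coe.1 hx)
      rw [Finset.mem_coe, Finset.mem_biUnion]
      exact ⟨p, hp, by rwa [Set.Finite.mem_toFinset, Metric.mem_closedEBall, edist_comm]⟩
  -- The injection `x ↦ (x, 0)` in the other direction has displacement zero, so the bijection
  -- assembled from the two injections keeps the bound `R`.
  obtain ⟨g, hg, hgR⟩ := Function.Embedding.schroeder_bernstein_of_rel hf
    (g := fun x : X => (x, (0 : Fin n))) (fun x y hxy => (Prod.ext_iff.1 hxy).1)
    (fun p y => edist p.1 y ≤ ENNReal.ofReal R)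
    (fun p => by
      have := hfR p
      rwa [Set.Finite.mem_toFinset, Metric.mem_closedEBall, edist_comm] at this)
    (fun y => by simp)
  exact ⟨R, g, hg, hgR⟩

end Neighbourhoods

/-! ### Partial translations and their operators. -/

namespace PartialTranslation

variable {X : Type*} [EMetricSpace X]

/-- The restriction of a map with bounded displacement to a subset on which it is injective. -/
def ofInjOn (f : X → X) (A : Set X) (hf : Set.InjOn f A) (r : ℝ≥0∞) (hr : r < ∞)
    (h : ∀ x ∈ A, edist x (f x) ≤ r) : PartialTranslation X where
  dom := A
  ran := f '' A
  toEquiv := Equiv.Set.imageOfInjOn f A hf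
  controlled := (iSup_le fun x : A => h x x.2).trans_lt hr

/-- The inverse partial translation. -/
def symm (t : PartialTranslation X) : PartialTranslation X where
  dom := t.ran
  ran := t.dom
  toEquiv := t.toEquiv.symm
  controlled := by
    refine lt_of_le_of_lt (iSup_le fun y => ?_) t.controlled
    have := le_iSup (fun x : t.dom => edist (x : X) (t.toEquiv x : X)) (t.toEquiv.symm y)
    simpa [edist_comm] using this

variable (K : Type*) [Field K]

theorem toEnd_single_of_mem (t : PartialTranslation X) {x : X} (hx : x ∈ t.dom) :
    t.toEnd K (Finsupp.single x 1) = Finsupp.single (t.toEquiv ⟨x, hx⟩ : X) 1 := by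
  simp [toEnd, hx]

theorem toEnd_single_of_notMem (t : PartialTranslation X) {x : X} (hx : x ∉ t.dom) :
    t.toEnd K (Finsupp.single x 1) = 0 := by
  simp [toEnd, hx]

theorem toEnd_ofInjOn_single_of_mem {f : X → X} {A : Set X} (hf : Set.InjOn f A) {r : ℝ≥0∞}
    (hr : r < ∞) (h : ∀ x ∈ A, edist x (f x) ≤ r) {x : X} (hx : x ∈ A) :
    (ofInjOn f A hf r hr h).toEnd K (Finsupp.single x 1) = Finsupp.single (f x) 1 :=
  toEnd_single_of_mem K _ hx

theorem toEnd_symm_ofInjOn_single {f : X → X} {A : Set X} (hf : Set.InjOn f A) {r : ℝ≥0∞}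
    (hr : r < ∞) (h : ∀ x ∈ A, edist x (f x) ≤ r) {x : X} (hx : x ∈ A) :
    (ofInjOn f A hf r hr h).symm.toEnd K (Finsupp.single (f x) 1) = Finsupp.single x 1 := by
  rw [toEnd_single_of_mem K _ (show f x ∈ (ofInjOn f A hf r hr h).symm.dom from ⟨x, hx, rfl⟩)]
  congr 1
  exact congrArg Subtype.val ((Equiv.Set.imageOfInjOn f A hf).symm_apply_apply ⟨x, hx⟩)

theorem toEnd_symm_ofInjOn_single_of_notMem {f : X → X} {A : Set X} (hf : Set.InjOn f A)
    {r : ℝ≥0∞} (hr : r < ∞) (h : ∀ x ∈ A, edist x (f x) ≤ r) {y : X} (hy : y ∉ f '' A) :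
    (ofInjOn f A hf r hr h).symm.toEnd K (Finsupp.single y 1) = 0 :=
  toEnd_single_of_notMem K _ hy

/-- The element of the translation algebra given by a partial translation. -/
def toAlgebra (t : PartialTranslation X) : translationAlgebra K X :=
  ⟨t.toEnd K, Algebra.subset_adjoin ⟨t, rfl⟩⟩

end PartialTranslation

/-! ### Matrix units, propagation and Følner subspaces. -/

section MatrixUnits

variable (K : Type*) [Field K] {X : Type*} [EMetricSpace X]

/-- A choice of a base point in each coarse component, that is, in each class of points at finite
distance. -/
def basePoint (x : X) : X :=
  (Quotient.mk (Metric.edistLtTopSetoid : Setoid X) x).out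

theorem edist_basePoint_lt_top (x : X) : edist (basePoint x) x < ∞ :=
  Quotient.exact (s := Metric.edistLtTopSetoid)
    (Quotient.out_eq (Quotient.mk (Metric.edistLtTopSetoid : Setoid X) x))

theorem basePoint_eq_of_edist_lt_top {x y : X} (h : edist x y < ∞) :
    basePoint x = basePoint y := by
  unfold basePoint
  rw [Quotient.sound (s := Metric.edistLtTopSetoid) h]

/-- The matrix unit that maps the base point of the coarse component of `x` to `x`. -/
def baseUnit (x : X) : translationAlgebra K X :=
  (PartialTranslation.ofInjOn (fun _ => x) {basePoint x} (Set.injOn_singleton _ _)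
    (edist (basePoint x) x) (edist_basePoint_lt_top x) (by rintro _ rfl; exact le_rfl)).toAlgebra K

theorem baseUnit_single_basePoint (x : X) :
    (baseUnit K x : Module.End K (X →₀ K)) (Finsupp.single (basePoint x) 1) =
      Finsupp.single x 1 :=
  PartialTranslation.toEnd_ofInjOn_single_of_mem K _ _ _ rfl

theorem baseUnit_single_of_ne {x y : X} (h : y ≠ basePoint x) :
    (baseUnit K x : Module.End K (X →₀ K)) (Finsupp.single y 1) = 0 :=
  PartialTranslation.toEnd_single_of_notMem K _ h

theorem linearIndependent_baseUnit :
    LinearIndependent K (baseUnit K : X → translationAlgebra K X) := by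
  classical
  -- `Φ a x` is the matrix entry of `a` at row `x` and column `basePoint x`; it sends the matrix
  -- units to the coordinate vectors.
  let Φ : translationAlgebra K X →ₗ[K] (X → K) :=
    LinearMap.pi fun x => Finsupp.lapply x ∘ₗ
      LinearMap.applyₗ (R := K) (Finsupp.single (basePoint x) (1 : K)) ∘ₗ
        (translationAlgebra K X).val.toLinearMap
  have hΦ : ∀ a x, Φ a x = (a : Module.End K (X →₀ K)) (Finsupp.single (basePoint x) 1) x :=
    fun _ _ => rfl
  refine LinearIndependent.of_comp Φ ?_
  have : Φ ∘ baseUnit K = fun x => Pi.single x (1 : K) := by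
    funext x y
    rw [Function.comp_apply, hΦ]
    by_cases h : basePoint y = basePoint x
    · rw [h, baseUnit_single_basePoint]
      simp [Finsupp.single_apply, Pi.single_apply, eq_comm]
    · rw [baseUnit_single_of_ne K h]
      have : y ≠ x := fun e => h (by rw [e])
      simp [this]
  rw [this]
  exact Pi.linearIndependent_single_one X K

/-- A partial translation does not leave a coarse component, so `x` and its image share a base
point. -/
theorem toAlgebra_mul_baseUnit_of_mem (t : PartialTranslation X) {x : X} (hx : x ∈ t.dom) :
    t.toAlgebra K * baseUnit K x = baseUnit K (t.toEquiv ⟨x, hx⟩ : X) := by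
  have hlt : edist x (t.toEquiv ⟨x, hx⟩ : X) < ∞ :=
    (le_iSup (fun x : t.dom => edist (x : X) (t.toEquiv x : X)) ⟨x, hx⟩).trans_lt t.controlled
  have hb := basePoint_eq_of_edist_lt_top hlt
  refine Subtype.ext (Finsupp.lhom_ext' fun y => LinearMap.ext_ring ?_)
  change t.toEnd K ((baseUnit K x : Module.End K (X →₀ K)) (Finsupp.single y 1)) =
    (baseUnit K (t.toEquiv ⟨x, hx⟩ : X) : Module.End K (X →₀ K)) (Finsupp.single y 1)
  by_cases hy : y = basePoint x
  · subst hy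
    rw [baseUnit_single_basePoint, t.toEnd_single_of_mem K hx]
    rw [hb, baseUnit_single_basePoint]
  · rw [baseUnit_single_of_ne K hy, map_zero, baseUnit_single_of_ne K (hb ▸ hy)]

theorem toAlgebra_mul_baseUnit_of_notMem (t : PartialTranslation X) {x : X} (hx : x ∉ t.dom) :
    t.toAlgebra K * baseUnit K x = 0 := by
  refine Subtype.ext (Finsupp.lhom_ext' fun y => LinearMap.ext_ring ?_)
  change t.toEnd K ((baseUnit K x : Module.End K (X →₀ K)) (Finsupp.single y 1)) = 0
  by_cases hy : y = basePoint x
  · subst hy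
    rw [baseUnit_single_basePoint, t.toEnd_single_of_notMem K hx]
  · rw [baseUnit_single_of_ne K hy, map_zero]

/-- Elements of the translation algebra have finite propagation. -/
theorem exists_mul_baseUnit_mem_span (a : translationAlgebra K X) :
    ∃ R : ℝ, 0 ≤ R ∧ ∀ x : X,
      a * baseUnit K x ∈ Submodule.span K (baseUnit K '' neighbourhood R {x}) := by
  obtain ⟨a, ha⟩ := a
  induction ha using Algebra.adjoin_induction with
  | mem a ha =>
    obtain ⟨t, rfl⟩ := ha
    refine ⟨(⨆ x : t.dom, edist (x : X) (t.toEquiv x : X)).toReal, ENNReal.toReal_nonneg,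
      fun x => ?_⟩
    rw [neighbourhood, ENNReal.ofReal_toReal t.controlled.ne]
    change t.toAlgebra K * baseUnit K x ∈ _
    by_cases hx : x ∈ t.dom
    · rw [toAlgebra_mul_baseUnit_of_mem K t hx]
      exact Submodule.subset_span ⟨_, ⟨x, rfl,
        le_iSup (fun x : t.dom => edist (x : X) (t.toEquiv x : X)) ⟨x, hx⟩⟩, rfl⟩
    · rw [toAlgebra_mul_baseUnit_of_notMem K t hx]
      exact zero_mem _
  | algebraMap r =>
    refine ⟨0, le_rfl, fun x => ?_⟩
    change algebraMap K (translationAlgebra K X) r * _ ∈ _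
    rw [← Algebra.smul_def]
    exact Submodule.smul_mem _ _ (Submodule.subset_span
      ⟨x, subset_neighbourhood _ _ rfl, rfl⟩)
  | add a b ha hb iha ihb =>
    obtain ⟨R, hR, iha⟩ := iha
    obtain ⟨S, hS, ihb⟩ := ihb
    refine ⟨R + S, add_nonneg hR hS, fun x => ?_⟩
    change ((⟨a, ha⟩ : translationAlgebra K X) + ⟨b, hb⟩) * _ ∈ _
    rw [add_mul]
    refine add_mem (Submodule.span_mono (Set.image_mono ?_) (iha x))
      (Submodule.span_mono (Set.image_mono ?_) (ihb x))
    · rintro y ⟨z, hz, hzy⟩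
      exact ⟨z, hz, hzy.trans (ENNReal.ofReal_le_ofReal (by linarith))⟩
    · rintro y ⟨z, hz, hzy⟩
      exact ⟨z, hz, hzy.trans (ENNReal.ofReal_le_ofReal (by linarith))⟩
  | mul a b ha hb iha ihb =>
    obtain ⟨R, hR, iha⟩ := iha
    obtain ⟨S, hS, ihb⟩ := ihb
    refine ⟨S + R, add_nonneg hS hR, fun x => ?_⟩
    change ((⟨a, ha⟩ : translationAlgebra K X) * ⟨b, hb⟩) * _ ∈ _
    rw [mul_assoc]
    have hle : Submodule.span K (baseUnit K '' neighbourhood S {x}) ≤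
        (Submodule.span K (baseUnit K '' neighbourhood (S + R) {x})).comap
          (LinearMap.mulLeft K (⟨a, ha⟩ : translationAlgebra K X)) := by
      rw [Submodule.span_le]
      rintro _ ⟨y, hy, rfl⟩
      refine Submodule.span_mono (Set.image_mono ?_) (iha y)
      refine subset_trans ?_ (neighbourhood_neighbourhood_subset hS hR {x})
      rintro z ⟨_, rfl, hz⟩
      exact ⟨_, hy, hz⟩
    exact hle (ihb x)

theorem exists_uniform_propagation (S : Finset (translationAlgebra K X)) :
    ∃ R : ℝ, 0 < R ∧ ∀ a ∈ S, ∀ x : X,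
      a * baseUnit K x ∈ Submodule.span K (baseUnit K '' neighbourhood R {x}) := by
  choose R hR hmem using exists_mul_baseUnit_mem_span K (X := X)
  -- The sum dominates each propagation bound; the `1` makes the radius positive, as amenability
  -- demands.
  refine ⟨∑ a ∈ S, R a + 1, add_pos_of_nonneg_of_pos (Finset.sum_nonneg fun a _ => hR a) one_pos,
    fun a ha x => Submodule.span_mono (Set.image_mono ?_) (hmem a x)⟩
  rintro y ⟨z, hz, hzy⟩
  refine ⟨z, hz, hzy.trans (ENNReal.ofReal_le_ofReal ?_)⟩
  linarith [Finset.single_le_sum (fun a _ => hR a) ha]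

/-- If `F` is Følner for the common propagation `R` of the given elements, then both `W = span {e_x
| x ∈ F}` and `a W` lie in the span over the `R`-neighbourhood of `F`, which exceeds `F` only by
points of the `R`-boundary. -/
theorem IsAmenable.isAlgebraicallyAmenable (hX : IsLocallyFinite X) (h : IsAmenable X) :
    IsAlgebraicallyAmenable K (translationAlgebra K X) := by
  intro ε hε S
  obtain ⟨R, hR, hS⟩ := exists_uniform_propagation K S
  obtain ⟨F, hF, hFε⟩ := h R hR ε hε
  have hrank : ∀ A : Set X, A.Finite →
      Module.finrank K (Submodule.span K (baseUnit K '' A)) = A.ncard := fun A hA => by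
    have := hA.fintype
    rw [Set.image_eq_range]
    refine (finrank_span_eq_card
      ((linearIndependent_baseUnit K (X := X)).comp ((↑) : A → X) Subtype.val_injective)).trans ?_
    rw [Fintype.card_eq_nat_card, Nat.card_coe_set_eq]
  have hfd : ∀ A : Set X, A.Finite →
      FiniteDimensional K (Submodule.span K (baseUnit K '' A)) := fun A hA =>
    FiniteDimensional.span_of_finite K (hA.image _)
  have hcard : (0 : ℝ) < F.card := by exact_mod_cast hF.card_pos
  have hN := hX.finite_neighbourhood R F.finite_toSet
  refine ⟨Submodule.span K (baseUnit K '' F), ?_, hfd _ F.finite_toSet, fun a ha => ?_⟩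
  · obtain ⟨x, hx⟩ := hF
    exact (Submodule.ne_bot_iff _).2 ⟨_, Submodule.subset_span ⟨x, hx, rfl⟩,
      (linearIndependent_baseUnit K).ne_zero x⟩
  have hle : (Submodule.span K (baseUnit K '' (F : Set X))).map (LinearMap.mulLeft K a) ⊔
      Submodule.span K (baseUnit K '' (F : Set X)) ≤
        Submodule.span K (baseUnit K '' neighbourhood R (F : Set X)) := by
    refine sup_le ?_ (Submodule.span_mono (Set.image_mono (subset_neighbourhood _ _)))
    rw [Submodule.map_le_iff_le_comap, Submodule.span_le]
    rintro _ ⟨x, hx, rfl⟩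
    refine Submodule.span_mono (Set.image_mono ?_) (hS a ha x)
    rintro y ⟨_, rfl, hy⟩
    exact ⟨_, hx, hy⟩
  have := hfd _ hN
  have h1 := Submodule.finrank_mono hle
  rw [hrank _ hN] at h1
  have h2 := Set.ncard_sdiff_add_ncard_of_subset (subset_neighbourhood R (F : Set X)) hN
  have h3 := Set.ncard_le_ncard (neighbourhood_diff_subset_rBoundary R (F : Set X))
    (hX.finite_rBoundary R F.finite_toSet)
  rw [hrank _ F.finite_toSet, Set.ncard_coe_finset, div_le_iff₀ hcard]
  rw [Set.ncard_coe_finset] at h2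
  rw [div_le_iff₀ hcard] at hFε
  have h4 := h1.trans (h2.ge.trans (Nat.add_le_add_right h3 _))
  have h5 := (Nat.cast_le (α := ℝ)).2 h4
  push_cast at h5
  linarith

end MatrixUnits

/-! ### Proper infiniteness against algebraic amenability. -/

section ProperlyInfinite

variable {A : Type*} [Ring A]

theorem isProperlyInfinite_iff : IsProperlyInfinite A ↔ Nontrivial A ∧
    ∃ x₁ x₂ y₁ y₂ : A, y₁ * x₁ = 1 ∧ y₂ * x₂ = 1 ∧ y₁ * x₂ = 0 ∧ y₂ * x₁ = 0 := by
  refine and_congr_right fun _ => ⟨?_, ?_⟩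
  · rintro ⟨-, e₁, e₂, -, -, he₁, he₂, h12, h21, ⟨x, y, hxy, hyx⟩, ⟨y', x', hyx', hxy'⟩⟩
    -- Inserting the idempotents makes the cross products vanish by orthogonality, and leaves the
    -- left inverses intact.
    refine ⟨e₁ * x, e₂ * x', y * e₁, y' * e₂, ?_, ?_, ?_, ?_⟩
    · rw [mul_assoc, ← mul_assoc e₁ e₁, he₁.eq, hxy, mul_assoc, ← hyx, mul_one, ← hyx]
    · rw [mul_assoc, ← mul_assoc e₂ e₂, he₂.eq, hxy', mul_assoc, ← hyx', mul_one, ← hyx']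
    · rw [mul_assoc, ← mul_assoc e₁ e₂, h12, zero_mul, mul_zero]
    · rw [mul_assoc, ← mul_assoc e₂ e₁, h21, zero_mul, mul_zero]
  · rintro ⟨x₁, x₂, y₁, y₂, h11, h22, h12, h21⟩
    have mul_mul_mul : ∀ a b c d : A, a * b * (c * d) = a * (b * c) * d := fun a b c d => by
      simp only [mul_assoc]
    refine ⟨IsIdempotentElem.one, x₁ * y₁, x₂ * y₂, ⟨x₁ * y₁, by simp⟩, ⟨x₂ * y₂, by simp⟩,
      ?_, ?_, ?_, ?_, ⟨x₁, y₁, rfl, h11.symm⟩, ⟨y₂, x₂, h22.symm, rfl⟩⟩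
    · rw [IsIdempotentElem, mul_mul_mul, h11, mul_one]
    · rw [IsIdempotentElem, mul_mul_mul, h22, mul_one]
    · rw [mul_mul_mul, h12, mul_zero, zero_mul]
    · rw [mul_mul_mul, h21, mul_zero, zero_mul]

theorem IsAlgebraicallyAmenable.not_isProperlyInfinite (K : Type*) [Field K] [Algebra K A]
    (h : IsAlgebraicallyAmenable K A) : ¬ IsProperlyInfinite A := by
  classical
  rw [isProperlyInfinite_iff]
  rintro ⟨-, x₁, x₂, y₁, y₂, h11, h22, h12, h21⟩
  -- With `d = dim W`, the sum of `x₁ W + W` and `x₂ W + W` has dimension at least `2 d`, and at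
  -- most `2 (1 + ε) d - d`, as both contain `W`. This is a contradiction for any `ε < 1 / 2`.
  obtain ⟨W, hW, hfd, hS⟩ := h (1 / 4) (by norm_num) {x₁, x₂}
  have inj : ∀ x y : A, y * x = 1 → Function.Injective (LinearMap.mulLeft K x) := by
    intro x y hyx a b hab
    have : y * (x * a) = y * (x * b) := congrArg (y * ·) hab
    rwa [← mul_assoc, ← mul_assoc, hyx, one_mul, one_mul] at this
  set M₁ := W.map (LinearMap.mulLeft K x₁) with hM₁
  set M₂ := W.map (LinearMap.mulLeft K x₂) with hM₂
  have hd₁ : Module.finrank K M₁ = Module.finrank K W :=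
    (Submodule.equivMapOfInjective _ (inj _ _ h11) W).symm.finrank_eq
  have hd₂ : Module.finrank K M₂ = Module.finrank K W :=
    (Submodule.equivMapOfInjective _ (inj _ _ h22) W).symm.finrank_eq
  have hbot : M₁ ⊓ M₂ = ⊥ := by
    rw [eq_bot_iff]
    rintro _ ⟨⟨a, -, rfl⟩, ⟨b, -, hb⟩⟩
    have hab : x₂ * b = x₁ * a := hb
    have : y₁ * (x₁ * a) = 0 := by rw [← hab, ← mul_assoc, h12, zero_mul]
    rw [← mul_assoc, h11, one_mul] at this
    simp [this]
  have hpos : 0 < Module.finrank K W := by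
    rw [Module.finrank_pos_iff, Submodule.nontrivial_iff_ne_bot]
    exact hW
  have hposR : (0 : ℝ) < Module.finrank K W := by exact_mod_cast hpos
  have e₁ := hS x₁ (by simp)
  have e₂ := hS x₂ (by simp)
  rw [div_le_iff₀ hposR] at e₁ e₂
  have e₃ := Submodule.finrank_sup_add_finrank_inf_eq M₁ M₂
  rw [hbot, finrank_bot, hd₁, hd₂, add_zero] at e₃
  have e₄ := Submodule.finrank_sup_add_finrank_inf_eq (M₁ ⊔ W) (M₂ ⊔ W)
  have e₅ : Module.finrank K W ≤ Module.finrank K ↥((M₁ ⊔ W) ⊓ (M₂ ⊔ W)) :=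
    Submodule.finrank_mono (le_inf le_sup_right le_sup_right)
  have e₆ : Module.finrank K ↥(M₁ ⊔ M₂) ≤ Module.finrank K ↥((M₁ ⊔ W) ⊔ (M₂ ⊔ W)) :=
    Submodule.finrank_mono (sup_le_sup le_sup_left le_sup_left)
  have e₇ := (Nat.cast_le (α := ℝ)).2 (e₃ ▸ e₆)
  have e₈ := (Nat.cast_le (α := ℝ)).2 e₅
  have e₉ := congrArg (Nat.cast : ℕ → ℝ) e₄
  push_cast at e₇ e₉
  linarith

end ProperlyInfinite

/-! ### Words in Leavitt families. -/

/-- Two families of elements satisfying the relations of the Leavitt algebra of type `(1, n)`. -/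
structure IsLeavittFamily {ι A : Type*} [Fintype ι] [DecidableEq ι] [Ring A] (x y : ι → A) :
    Prop where
  sum_mul : ∑ j, x j * y j = 1
  mul_eq : ∀ j k, y j * x k = if j = k then 1 else 0

/-- The product of the elements of a family along a word. -/
def wordProd {ι A : Type*} [Monoid A] (x : ι → A) (w : List ι) : A :=
  (w.map x).prod

section WordProd

variable {ι A : Type*} [Monoid A] (x : ι → A)

@[simp]
theorem wordProd_nil : wordProd x [] = 1 := rfl

@[simp]
theorem wordProd_cons (i : ι) (w : List ι) : wordProd x (i :: w) = x i * wordProd x w := by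
  simp [wordProd]

@[simp]
theorem wordProd_append (v w : List ι) : wordProd x (v ++ w) = wordProd x v * wordProd x w := by
  simp [wordProd]

theorem map_wordProd {B F : Type*} [Monoid B] [FunLike F A B] [MonoidHomClass F A B] (φ : F)
    (w : List ι) : φ (wordProd x w) = wordProd (φ ∘ x) w := by
  simp [wordProd, map_list_prod]

end WordProd

namespace IsLeavittFamily

section

variable {ι A : Type*} [Fintype ι] [DecidableEq ι] [Ring A] {x y : ι → A}
  (h : IsLeavittFamily x y)
include h

theorem map {B F : Type*} [Ring B] [FunLike F A B] [RingHomClass F A B] (φ : F) :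
    IsLeavittFamily (φ ∘ x) (φ ∘ y) where
  sum_mul := by
    have := congrArg φ h.sum_mul
    simpa using this
  mul_eq j k := by
    have := congrArg φ (h.mul_eq j k)
    rw [map_mul] at this
    rw [Function.comp_apply, Function.comp_apply, this]
    split_ifs <;> simp

theorem wordProd_reverse_mul_self (w : List ι) : wordProd y w.reverse * wordProd x w = 1 := by
  induction w with
  | nil => simp
  | cons i w ih =>
    rw [List.reverse_cons, wordProd_append, wordProd_cons, wordProd_cons, wordProd_nil, mul_one,
      mul_assoc, ← mul_assoc (y i), h.mul_eq, if_pos rfl, one_mul, ih]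

theorem wordProd_reverse_mul_of_not_isPrefix (v w : List ι) (hlen : v.length ≤ w.length)
    (hvw : ¬ v <+: w) : wordProd y v.reverse * wordProd x w = 0 := by
  induction v generalizing w with
  | nil => exact absurd (List.nil_prefix) hvw
  | cons i v ih =>
    cases w with
    | nil => simp at hlen
    | cons j w =>
      rw [List.reverse_cons, wordProd_append, wordProd_cons, wordProd_cons, wordProd_nil, mul_one,
        mul_assoc, ← mul_assoc (y i), h.mul_eq]
      split_ifs with hij
      · subst hij
        rw [one_mul]
        refine ih w (by simpa using hlen) fun hp => hvw ?_
        exact List.cons_prefix_cons.2 ⟨rfl, hp⟩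
      · simp

/-- Since `∑ x j * y j = 1`, an element is recovered from its products with the `x j`; induction
extends this to all words of a fixed length. -/
theorem eq_zero_of_mul_wordProd_eq_zero (k : ℕ) (a : A)
    (ha : ∀ w : List ι, w.length = k → a * wordProd x w = 0) : a = 0 := by
  induction k with
  | zero => simpa using ha [] rfl
  | succ k ih =>
    refine ih fun w hw => ?_
    rw [← mul_one (a * wordProd x w), ← h.sum_mul, Finset.mul_sum]
    refine Finset.sum_eq_zero fun j _ => ?_
    have := ha (w ++ [j]) (by simp [hw])
    rw [wordProd_append, wordProd_cons, wordProd_nil, mul_one, ← mul_assoc] at this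
    rw [← mul_assoc, this, zero_mul]

/-- In a nontrivial algebra, the monomials in the isometries of a Leavitt family are linearly
independent. -/
theorem linearIndependent_wordProd (K : Type*) [Field K] [Algebra K A] [Nontrivial A]
    [Nontrivial ι] : LinearIndependent K (wordProd x) := by
  rw [linearIndependent_iff]
  intro p hp
  by_contra hne
  -- By minimality of its length, `v` is either a prefix of another word `w` of the support or
  -- incompatible with it, so cancelling `v` from `w` leaves a word in the `x` or zero.
  obtain ⟨v, hv, hmin⟩ :=
    p.support.exists_min_image List.length (Finsupp.support_nonempty_iff.2 hne)
  obtain ⟨i, j, hij⟩ := exists_pair_ne ι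
  set m := p.support.sup List.length
  -- The word `i ^ m j` detects the empty word: for nonempty `w` of length at most `m`, the letter
  -- at position `m` is `j` in `g` but `i` in `w ++ g`. Sandwiching with `g` therefore kills every
  -- nonempty remainder.
  set g := List.replicate m i ++ [j] with hg
  have hprefix : ∀ w : List ι, w ≠ [] → w.length ≤ m → ¬ g <+: w ++ g := by
    rintro w hw hwm ⟨t, ht⟩
    have hpos := List.length_pos_iff.2 hw
    have h1 : (g ++ t)[m]? = some j := by
      simp [hg]
    have h2 : (w ++ g)[m]? = some i := by
      rw [List.getElem?_append_right hwm, hg, List.getElem?_append_left (by simp; omega),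
        List.getElem?_replicate_of_lt (by omega)]
    rw [ht, h2] at h1
    exact hij (Option.some_injective _ h1)
  have hterm : ∀ w ∈ p.support, w ≠ v →
      wordProd y g.reverse * (wordProd y v.reverse * wordProd x w) * wordProd x g = 0 := by
    intro w hw hwv
    by_cases hpre : v <+: w
    · obtain ⟨u, rfl⟩ := hpre
      rw [wordProd_append, ← mul_assoc (wordProd y v.reverse), h.wordProd_reverse_mul_self,
        one_mul, mul_assoc, ← wordProd_append]
      refine h.wordProd_reverse_mul_of_not_isPrefix _ _ (by simp) (hprefix u ?_ ?_)
      · rintro rfl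
        simp at hwv
      · have := Finset.le_sup (f := List.length) hw
        rw [List.length_append] at this
        omega
    · rw [h.wordProd_reverse_mul_of_not_isPrefix v w (hmin w hw) hpre, mul_zero, zero_mul]
  have key : wordProd y g.reverse * (wordProd y v.reverse *
      Finsupp.linearCombination K (wordProd x) p) * wordProd x g = p v • (1 : A) := by
    rw [Finsupp.linearCombination_apply, Finsupp.sum, Finset.mul_sum, Finset.mul_sum,
      Finset.sum_mul, Finset.sum_eq_single v]
    · rw [mul_smul_comm, mul_smul_comm, smul_mul_assoc, h.wordProd_reverse_mul_self, mul_one,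
        h.wordProd_reverse_mul_self]
    · intro w hw hwv
      rw [mul_smul_comm, mul_smul_comm, smul_mul_assoc, hterm w hw hwv, smul_zero]
    · exact fun hv' => absurd hv hv'
  rw [hp, mul_zero, mul_zero, zero_mul] at key
  exact Finsupp.mem_support_iff.1 hv ((smul_eq_zero.1 key.symm).resolve_right one_ne_zero)

/-- Each `y i` cancels one leading letter, so a sufficiently long word absorbs all the `y` occurring
in `a`. -/
theorem exists_mul_wordProd_mem_span (K : Type*) [Field K] [Algebra K A] {a : A}
    (ha : a ∈ Algebra.adjoin K (Set.range x ∪ Set.range y)) :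
    ∃ k : ℕ, ∀ w : List ι, k ≤ w.length →
      a * wordProd x w ∈ Submodule.span K (Set.range (wordProd x)) := by
  induction ha using Algebra.adjoin_induction with
  | mem a ha =>
    rcases ha with ⟨i, rfl⟩ | ⟨i, rfl⟩
    · exact ⟨0, fun w _ => Submodule.subset_span ⟨i :: w, wordProd_cons x i w⟩⟩
    · refine ⟨1, fun w hw => ?_⟩
      cases w with
      | nil => simp at hw
      | cons j w =>
        rw [wordProd_cons, ← mul_assoc, h.mul_eq]
        split_ifs
        · exact Submodule.subset_span ⟨w, (one_mul _).symm⟩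
        · simp
  | algebraMap r =>
    refine ⟨0, fun w _ => ?_⟩
    rw [← Algebra.smul_def]
    exact Submodule.smul_mem _ _ (Submodule.subset_span ⟨w, rfl⟩)
  | add a b _ _ iha ihb =>
    obtain ⟨k, iha⟩ := iha
    obtain ⟨l, ihb⟩ := ihb
    refine ⟨max k l, fun w hw => ?_⟩
    rw [add_mul]
    exact add_mem (iha w ((le_max_left _ _).trans hw)) (ihb w ((le_max_right _ _).trans hw))
  | mul a b _ _ iha ihb =>
    obtain ⟨k, iha⟩ := iha
    obtain ⟨l, ihb⟩ := ihb
    -- The first `l` letters absorb `b`; at least `k` letters remain behind every resulting word,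
    -- enough to absorb `a`.
    refine ⟨l + k, fun w hw => ?_⟩
    have hb := ihb (w.take l) (by rw [List.length_take]; omega)
    have hle : Submodule.span K (Set.range (wordProd x)) ≤
        (Submodule.span K (Set.range (wordProd x))).comap
          (LinearMap.mulLeft K a ∘ₗ LinearMap.mulRight K (wordProd x (w.drop l))) := by
      rw [Submodule.span_le]
      rintro _ ⟨v, rfl⟩
      have := iha (v ++ w.drop l) (by rw [List.length_append, List.length_drop]; omega)
      rwa [wordProd_append] at this
    have := hle hb
    rw [Submodule.mem_comap, LinearMap.comp_apply, LinearMap.mulLeft_apply,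
      LinearMap.mulRight_apply, mul_assoc b, ← wordProd_append, List.take_append_drop,
      ← mul_assoc] at this
    exact this

/-- A homomorphism from an algebra generated by a Leavitt family to a nontrivial algebra is
injective. -/
theorem injective_algHom {K : Type*} [Field K] [Algebra K A] [Nontrivial ι]
    (htop : Algebra.adjoin K (Set.range x ∪ Set.range y) = ⊤) {B : Type*} [Ring B] [Algebra K B]
    [Nontrivial B] (φ : A →ₐ[K] B) : Function.Injective φ := by
  rw [injective_iff_map_eq_zero]
  intro a ha
  obtain ⟨k, hk⟩ := h.exists_mul_wordProd_mem_span K (a := a) (htop ▸ Algebra.mem_top)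
  -- For long `w` the product `a * wordProd x w` is a combination of words. Its image vanishes, and
  -- words in the image family are independent, so all coefficients are zero.
  refine h.eq_zero_of_mul_wordProd_eq_zero k a fun w hw => ?_
  obtain ⟨p, hp⟩ := (Finsupp.mem_span_range_iff_exists_finsupp).1 (hk w hw.ge)
  have h0 : φ (a * wordProd x w) = 0 := by rw [map_mul, ha, zero_mul]
  rw [← hp, Finsupp.sum, map_sum] at h0
  have hp0 : p = 0 := by
    refine linearIndependent_iff.1 ((h.map φ).linearIndependent_wordProd K) p ?_
    rw [Finsupp.linearCombination_apply, Finsupp.sum, ← h0]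
    exact Finset.sum_congr rfl fun v _ => by rw [map_smul, map_wordProd]
  rw [← hp, hp0, Finsupp.sum_zero_index]

end

end IsLeavittFamily

/-! ### The Leavitt algebra of type (1, n). -/

section Leavitt

variable (K : Type*) [Field K] (n : ℕ)

/-- The generators `X j` of `L(1, n)`. -/
def leavittGenX (j : Fin n) : LeavittAlgebra K 1 n :=
  RingQuot.mkAlgHom K (LeavittRel K 1 n) (leavittX K 1 n 0 j)

/-- The generators `Y j` of `L(1, n)`. -/
def leavittGenY (j : Fin n) : LeavittAlgebra K 1 n :=
  RingQuot.mkAlgHom K (LeavittRel K 1 n) (leavittY K 1 n j 0)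

theorem isLeavittFamily_leavittGen : IsLeavittFamily (leavittGenX K n) (leavittGenY K n) where
  sum_mul := by
    have := RingQuot.mkAlgHom_rel K (LeavittRel.xy (K := K) (m := 1) (n := n) 0 0)
    rw [Matrix.mul_apply, Matrix.one_apply_eq, map_sum, map_one] at this
    rw [← this]
    exact Finset.sum_congr rfl fun j _ => (map_mul _ _ _).symm
  mul_eq j k := by
    have := RingQuot.mkAlgHom_rel K (LeavittRel.yx (K := K) (m := 1) (n := n) j k)
    rw [Matrix.mul_apply, Fin.sum_univ_one, map_mul, Matrix.one_apply] at this
    refine this.trans ?_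
    split_ifs <;> simp

theorem adjoin_leavittGen :
    Algebra.adjoin K (Set.range (leavittGenX K n) ∪ Set.range (leavittGenY K n)) = ⊤ := by
  have h := congrArg (Subalgebra.map (RingQuot.mkAlgHom K (LeavittRel K 1 n)))
    (FreeAlgebra.adjoin_range_ι (R := K) (X := LeavittGen 1 n))
  rw [AlgHom.map_adjoin, Algebra.map_top,
    (AlgHom.range_eq_top _).2 (RingQuot.mkAlgHom_surjective K _)] at h
  rw [eq_top_iff, ← h]
  refine Algebra.adjoin_mono ?_
  rintro _ ⟨_, ⟨⟨i, j⟩ | ⟨j, i⟩, rfl⟩, rfl⟩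
  · exact Or.inl ⟨j, by rw [Subsingleton.elim i 0]; rfl⟩
  · exact Or.inr ⟨j, by rw [Subsingleton.elim i 0]; rfl⟩

variable {K n} {A : Type*} [Ring A] [Algebra K A]

theorem IsLeavittFamily.exists_algHom {x y : Fin n → A} (h : IsLeavittFamily x y) :
    Nonempty (LeavittAlgebra K 1 n →ₐ[K] A) := by
  refine ⟨RingQuot.liftAlgHom K ⟨FreeAlgebra.lift K
    (Sum.elim (fun p : Fin 1 × Fin n => x p.2) fun p : Fin n × Fin 1 => y p.1), ?_⟩⟩
  rintro _ _ (⟨i, i'⟩ | ⟨j, j'⟩)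
  · rw [Subsingleton.elim i' i, Matrix.mul_apply, Matrix.one_apply_eq, map_sum, map_one,
      ← h.sum_mul]
    refine Finset.sum_congr rfl fun j _ => ?_
    simp [leavittX, leavittY]
  · rw [Matrix.mul_apply, Fin.sum_univ_one, Matrix.one_apply, map_mul]
    have := h.mul_eq j j'
    split_ifs at this ⊢ <;> simpa [leavittX, leavittY] using this

/-- Injectivity comes for free: every unital homomorphism from this Leavitt algebra to a nontrivial
algebra is injective. -/
theorem containsUnitally_leavittAlgebra_iff [Nontrivial A] (hn : 2 ≤ n) :
    ContainsUnitally K A (LeavittAlgebra K 1 n) ↔ ∃ x y : Fin n → A, IsLeavittFamily x y := by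
  have : Nontrivial (Fin n) := Fin.nontrivial_iff_two_le.2 hn
  refine ⟨fun ⟨φ, _⟩ => ⟨_, _, (isLeavittFamily_leavittGen K n).map φ⟩, ?_⟩
  rintro ⟨x, y, h⟩
  obtain ⟨φ⟩ := h.exists_algHom (K := K)
  exact ⟨φ, (isLeavittFamily_leavittGen K n).injective_algHom (adjoin_leavittGen K n) φ⟩

theorem IsLeavittFamily.isProperlyInfinite [Nontrivial A] {ι : Type*} [Fintype ι] [DecidableEq ι]
    [Nontrivial ι] {x y : ι → A} (h : IsLeavittFamily x y) : IsProperlyInfinite A := by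
  obtain ⟨i, j, hij⟩ := exists_pair_ne ι
  refine isProperlyInfinite_iff.2 ⟨inferInstance, x i, x j, y i, y j, ?_, ?_, ?_, ?_⟩
  · rw [h.mul_eq, if_pos rfl]
  · rw [h.mul_eq, if_pos rfl]
  · rw [h.mul_eq, if_neg hij]
  · rw [h.mul_eq, if_neg hij.symm]

end Leavitt

/-! ### Leavitt families from paradoxical decompositions. -/

section Main

variable (K : Type*) [Field K] {X : Type*} [EMetricSpace X]

instance [Nonempty X] : Nontrivial (translationAlgebra K X) := by
  obtain ⟨x⟩ := ‹Nonempty X›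
  exact ⟨⟨_, 0, (linearIndependent_baseUnit K).ne_zero x⟩⟩

theorem IsLocallyFinite.exists_isLeavittFamily (hX : IsLocallyFinite X) (h : ¬ IsAmenable X)
    (n : ℕ) [NeZero n] : ∃ x y : Fin n → translationAlgebra K X, IsLeavittFamily x y := by
  obtain ⟨R, f, hf, hfR⟩ := hX.exists_paradoxical h n
  let t : Fin n → PartialTranslation X := fun i =>
    PartialTranslation.ofInjOn (fun x => f (x, i)) Set.univ
      (fun x _ y _ hxy => (Prod.ext_iff.1 (hf.1 hxy)).1) (ENNReal.ofReal R) ENNReal.ofReal_lt_top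
      fun x _ => hfR (x, i)
  have ht : ∀ i x, (t i).toEnd K (Finsupp.single x 1) = Finsupp.single (f (x, i)) 1 := fun i x =>
    PartialTranslation.toEnd_ofInjOn_single_of_mem K _ _ _ (Set.mem_univ x)
  have hs : ∀ i j x, (t i).symm.toEnd K (Finsupp.single (f (x, j)) 1) =
      if i = j then Finsupp.single x 1 else 0 := by
    intro i j x
    split_ifs with hij
    · subst hij
      exact PartialTranslation.toEnd_symm_ofInjOn_single K
        (fun x _ y _ hxy => (Prod.ext_iff.1 (hf.1 hxy)).1) _ _ (Set.mem_univ x)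
    · refine PartialTranslation.toEnd_symm_ofInjOn_single_of_notMem K
        (fun x _ y _ hxy => (Prod.ext_iff.1 (hf.1 hxy)).1) _ _ ?_
      rintro ⟨y, -, hy⟩
      exact hij (Prod.ext_iff.1 (hf.1 hy)).2
  refine ⟨fun i => (t i).toAlgebra K, fun i => (t i).symm.toAlgebra K, ?_, ?_⟩
  · refine Subtype.ext (Finsupp.lhom_ext' fun y => LinearMap.ext_ring ?_)
    -- Each point lies in the range of exactly one branch of `f`, so only the `j`-th summand
    -- survives.
    obtain ⟨⟨x, j⟩, rfl⟩ := hf.2 y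
    rw [AddSubmonoidClass.coe_finsetSum]
    rw [LinearMap.comp_apply, LinearMap.sum_apply]
    change ∑ i, (t i).toEnd K ((t i).symm.toEnd K (Finsupp.single (f (x, j)) 1)) =
      Finsupp.single (f (x, j)) 1
    rw [Finset.sum_eq_single j]
    · rw [hs, if_pos rfl, ht]
    · intro i _ hij
      rw [hs, if_neg hij, map_zero]
    · simp
  · intro i j
    refine Subtype.ext (Finsupp.lhom_ext' fun x => LinearMap.ext_ring ?_)
    have : (t i).symm.toEnd K ((t j).toEnd K (Finsupp.single x 1)) =
        if i = j then Finsupp.single x 1 else 0 := by rw [ht, hs]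
    refine this.trans ?_
    split_ifs <;> rfl

end Main

end CoarseAmenability

end

theorem theorem6p2 (K : Type*) [Field K] (X : Type*) [EMetricSpace X] [Nonempty X]
    (hX : CoarseAmenability.IsLocallyFinite X) (n : ℕ) (hn : 2 ≤ n) :
    List.TFAE
      [CoarseAmenability.IsAmenable X,
       CoarseAmenability.IsAlgebraicallyAmenable K (CoarseAmenability.translationAlgebra K X),
       ¬ CoarseAmenability.IsProperlyInfinite (CoarseAmenability.translationAlgebra K X),
       ¬ CoarseAmenability.ContainsUnitally K (CoarseAmenability.translationAlgebra K X)
          (CoarseAmenability.LeavittAlgebra K 1 n)] := by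
  have : Nontrivial (Fin n) := Fin.nontrivial_iff_two_le.2 hn
  have : NeZero n := ⟨by omega⟩
  tfae_have 1 → 2 := CoarseAmenability.IsAmenable.isAlgebraicallyAmenable K hX
  tfae_have 2 → 3 := CoarseAmenability.IsAlgebraicallyAmenable.not_isProperlyInfinite K
  tfae_have 3 → 4 := fun h3 hc => by
    obtain ⟨x, y, h⟩ := (CoarseAmenability.containsUnitally_leavittAlgebra_iff hn).1 hc
    exact h3 h.isProperlyInfinite
  tfae_have 4 → 1 := fun h4 => by
    by_contra h1
    exact h4 ((CoarseAmenability.containsUnitally_leavittAlgebra_iff hn).2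
      (hX.exists_isLeavittFamily K h1 n))
  tfae_finish
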